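/- For a finite group $G$, Harada's number is $$h(G)=\frac{\prod_{K}|K|}{\prod_{\chi}\chi(1)},$$ where $K$ runs over the conjugacy classes of $G$ and $\chi$ over the irreducible complex characters of $G$. If $Z$ is a central subgroup of $G$, then $Z$ acts on the set of conjugacy classes of $G$ by $(z,K)\mapsto zK$. For a subgroup $N\le Z$, let $|I(G:Z)_N|$ denote the number of $Z$-orbits of conjugacy classes $K$ of $G$ with $\{z\in Z : zK=K\}=N$. **Theorem.** Let $G_1$ and $G_2$ be finite groups containing central subgroups $H_1\le Z(G_1)$ and $H_2\le Z(G_2)$, respectively, both of the same prime order $p$. Let $\theta:H_1\to H_2$ be a group isomorphism and let $$G=(G_1\times G_2)/\{(x,\theta(x^{-1})) : x\in H_1\}$$ be the central product of $G_1$ and $G_2$ with respect to $H_1$, $H_2$ (and $\theta$). Then $$\begin{aligned}h(G)={}&p^{|I(G_1:H_1)_{H_1}|\,|I(G_2:H_2)_{H_2}|}\\ &\times h(G_1)^{|I(G_2:H_2)_{\{1\}}|}\,h(G_2)^{|I(G_1:H_1)_{\{1\}}|}\\ &\times h(G_1/H_1)^{|I(G_2:H_2)_{H_2}|}\,h(G_2/H_2)^{|I(G_1:H_1)_{H_1}|}.\end{aligned}$$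 In particular, if $h(G_1)$, $h(G_2)$, $h(G_1/H_1)$ and $h(G_2/H_2)$ are all integers, then so is $h(G)$. -/

import Mathlib

noncomputable section

namespace Harada

/-! ### Irreducible characters and the number `h(G)` -/

/-- `Irr(G)`: the set of characters of the irreducible complex representations of `G`. Every
finite-dimensional complex representation is isomorphic to one on some `ℂⁿ`. -/
def irrChar (G : Type*) [Group G] : Set (G → ℂ) :=
  {χ | ∃ (n : ℕ) (ρ : Representation ℂ G (Fin n → ℂ)), ρ.IsIrreducible ∧ ρ.character = χ}

/-- A finite group has only finitely many irreducible characters, so that the product over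
`irrChar G` in `haradaNumber` is a genuine finite product. -/
theorem irrChar_finite (G : Type*) [Group G] [Finite G] : (irrChar G).Finite := by
  classical
  have := Fintype.ofFinite G
  have hcard : (Nat.card G : ℂ) ≠ 0 := Nat.cast_ne_zero.mpr Nat.card_pos.ne'
  let _ : Invertible (Nat.card G : ℂ) := invertibleOfNonzero hcard
  -- the pairing of characters
  let B : (G → ℂ) → (G → ℂ) →ₗ[ℂ] ℂ := fun ψ =>
    { toFun := fun f => (Nat.card G : ℂ)⁻¹ * ∑ g : G, f g * ψ g⁻¹
      map_add' := by
        intro a b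
        simp only [Pi.add_apply, add_mul, Finset.sum_add_distrib, mul_add]
      map_smul' := by
        intro c a
        simp only [Pi.smul_apply, smul_eq_mul, RingHom.id_apply, mul_assoc, ← Finset.mul_sum]
        ring }
  have hB : ∀ χ ∈ irrChar G, ∀ ψ ∈ irrChar G, B ψ χ = if χ = ψ then 1 else 0 := by
    rintro χ ⟨n, ρ, hρ, rfl⟩ ψ ⟨m, σ, hσ, rfl⟩
    have key := Representation.char_orthonormal ρ σ
    have key1 := Representation.char_orthonormal ρ ρ
    rw [if_pos ⟨Representation.Equiv.refl ρ⟩] at key1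
    change (Nat.card G : ℂ)⁻¹ * ∑ g : G, ρ.character g * σ.character g⁻¹ = _
    by_cases h : ρ.character = σ.character
    · rw [if_pos h, ← h]
      exact key1
    · rw [if_neg h, key, if_neg]
      rintro ⟨e⟩
      exact h (Representation.char_iso e).symm
  have hli : LinearIndependent ℂ (fun χ : irrChar G => (χ : G → ℂ)) := by
    rw [linearIndependent_iff']
    intro s c hc i hi
    have h1 := congrArg (B i) hc
    rw [map_sum, map_zero] at h1
    simp only [map_smul, smul_eq_mul] at h1
    rw [Finset.sum_eq_single i] at h1
    · simpa [hB i i.2 i i.2] using h1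
    · intro j _ hj
      rw [hB j j.2 i i.2, if_neg (fun h => hj (Subtype.ext h)), mul_zero]
    · exact fun h => absurd hi h
  have hfin : Finite (irrChar G) := hli.finite
  exact Set.toFinite _

/-- Harada's number `h(G)`: the product of the sizes of the conjugacy classes of `G` divided by
the product of the degrees `χ(1)` of its irreducible complex characters. -/
def haradaNumber (G : Type*) [Group G] : ℂ :=
  (∏ᶠ K : ConjClasses G, (Nat.card K.carrier : ℂ)) / ∏ᶠ χ ∈ irrChar G, χ 1

/-! ### The action of a central subgroup on conjugacy classes -/

/-- The action `(z, K) ↦ zK` of a central subgroup `Z` on the set of conjugacy classes. -/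
@[reducible] def centralAction {G : Type*} [Group G] (Z : Subgroup G) (hZ : Z ≤ Subgroup.center G) :
    MulAction Z (ConjClasses G) where
  smul z := Quotient.map (fun g : G => (z : G) * g) (by
    intro a b hab
    obtain ⟨c, hc⟩ := isConj_iff.mp hab
    refine isConj_iff.mpr ⟨c, ?_⟩
    have hz : c * (z : G) = z * c := Subgroup.mem_center_iff.mp (hZ z.2) c
    rw [← hc, ← mul_assoc c, hz]
    simp only [mul_assoc])
  one_smul := by
    rintro ⟨g⟩
    exact congrArg ConjClasses.mk (one_mul g)
  mul_smul := by
    rintro x y ⟨g⟩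
    exact congrArg ConjClasses.mk (mul_assoc (x : G) y g)

/-- `Ann_Z(K) = {z ∈ Z | zK = K}`, as a subgroup of `G`. -/
def ann {G : Type*} [Group G] (Z : Subgroup G) (hZ : Z ≤ Subgroup.center G)
    (K : ConjClasses G) : Subgroup G :=
  letI := centralAction Z hZ
  (MulAction.stabilizer Z K).map Z.subtype

/-- The set of `Z`-orbits of those conjugacy classes `K` of `G` for which `Ann_Z(K) = N`. -/
def orbitsWithAnn {G : Type*} [Group G] (Z : Subgroup G) (hZ : Z ≤ Subgroup.center G)
    (N : Subgroup G) : Set (Set (ConjClasses G)) :=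
  letI := centralAction Z hZ
  {O | ∃ K : ConjClasses G, ann Z hZ K = N ∧ MulAction.orbit Z K = O}

/-- `|I(G : Z)_N|`, the number of `Z`-orbits of conjugacy classes `K` with `Ann_Z(K) = N`. -/
def orbitCount {G : Type*} [Group G] (Z : Subgroup G) (hZ : Z ≤ Subgroup.center G)
    (N : Subgroup G) : ℕ :=
  (orbitsWithAnn Z hZ N).ncard

/-! ### Central products -/

theorem normal_of_central {G : Type*} [Group G] {H : Subgroup G} (hH : H ≤ Subgroup.center G) :
    H.Normal where
  conj_mem n hn g := by
    rw [Subgroup.mem_center_iff.mp (hH hn) g, mul_assoc, mul_inv_cancel, mul_one]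
    exact hn

variable {G₁ G₂ : Type*} [Group G₁] [Group G₂] {H₁ : Subgroup G₁} {H₂ : Subgroup G₂}

/-- The subgroup `N = {(h, θ(h⁻¹)) | h ∈ H₁}` of `G₁ × G₂`. -/
def centralProductKernel (hH₁ : H₁ ≤ Subgroup.center G₁) (_hH₂ : H₂ ≤ Subgroup.center G₂)
    (θ : H₁ ≃* H₂) : Subgroup (G₁ × G₂) where
  carrier := {x | ∃ h : H₁, x = ((h : G₁), (θ h⁻¹ : G₂))}
  one_mem' := ⟨1, by simp [Prod.ext_iff]⟩
  mul_mem' := by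
    rintro _ _ ⟨a, rfl⟩ ⟨b, rfl⟩
    have hab : a * b = b * a :=
      Subtype.ext (Subgroup.mem_center_iff.mp (hH₁ b.2) a)
    refine ⟨a * b, Prod.ext rfl ?_⟩
    change (θ a⁻¹ : G₂) * (θ b⁻¹ : G₂) = (θ (a * b)⁻¹ : G₂)
    rw [hab, mul_inv_rev, map_mul, Subgroup.coe_mul]
  inv_mem' := by
    rintro _ ⟨a, rfl⟩
    refine ⟨a⁻¹, Prod.ext rfl ?_⟩
    change (θ a⁻¹ : G₂)⁻¹ = (θ a⁻¹⁻¹ : G₂)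
    rw [map_inv θ a⁻¹, Subgroup.coe_inv]

instance centralProductKernel_normal (hH₁ : H₁ ≤ Subgroup.center G₁)
    (hH₂ : H₂ ≤ Subgroup.center G₂) (θ : H₁ ≃* H₂) :
    (centralProductKernel hH₁ hH₂ θ).Normal :=
  normal_of_central (by
    rintro _ ⟨h, rfl⟩
    rw [Subgroup.mem_center_iff]
    rintro ⟨x, y⟩
    exact Prod.ext (Subgroup.mem_center_iff.mp (hH₁ h.2) x)
      (Subgroup.mem_center_iff.mp (hH₂ (θ h⁻¹).2) y))

/-- The central product `(G₁ × G₂) / N` of `G₁` and `G₂` with respect to the central subgroups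
`H₁`, `H₂` and the isomorphism `θ : H₁ ≃* H₂`. -/
abbrev CentralProduct (hH₁ : H₁ ≤ Subgroup.center G₁) (hH₂ : H₂ ≤ Subgroup.center G₂)
    (θ : H₁ ≃* H₂) : Type _ :=
  (G₁ × G₂) ⧸ centralProductKernel hH₁ hH₂ θ

end Harada

end

/-! The numerator and the denominator of `h` are computed separately. For a central subgroup `Z` of
prime order `p`, every class is either fixed by `Z` or lies in a free orbit of length `p`. Let `b`
be the number of fixed classes and `a` the number of free orbits, so that `G` has `p * a + b`
classes.

Class sizes: a fixed class has `p` times the size of its image in `G ⧸ Z`, while the `p` classes of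
a free orbit share one image, of the same size as each of them. If `P`, `Q`, `F` are the products of
the class sizes of `G`, of `G ⧸ Z`, and of the fixed classes of `G`, then `p ^ (p * b) * Q ^ p = F ^
(p - 1) * P` (`prod_card_carrier_quotient`). This identity is used three times: for `G₁`, for `G₂`,
and for `G₁ × G₂` modulo the kernel of the central product. A pair of classes is fixed by that
kernel exactly when both members are fixed, so the data of the product are `b = b₁ * b₂`, `F = F₁ ^
b₂ * F₂ ^ b₁` and `P = P₁ ^ (p * a₂ + b₂) * P₂ ^ (p * a₁ + b₁)`. Eliminating `F₁` and `F₂` gives the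
numerator, and it is here that the power of `p` appears.

Degrees: the irreducible characters of the central product are the pairs `(χ₁, χ₂)` whose central
characters agree through `θ`. Computing the trace of `z ∈ Z` on class functions in two bases, then
applying Fourier inversion on `Z`, shows that `a` irreducible characters lie over each nontrivial
linear character of `Z` and `a + b` over the trivial one (`card_centralCharacter_eq`). Hence `χ₁`
has `a₂` partners, and `b₂` more when it comes from `G₁ ⧸ H₁`; symmetrically for `χ₂`. The
denominator thus has the same shape as the numerator, without the power of `p`. -/

open Representation Module

namespace Harada

/-! ### Irreducible representations and their characters -/

section Representations

variable {G : Type*} [Group G] {V : Type*} [AddCommGroup V] [Module ℂ V]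

/-- Schur's lemma: an endomorphism commuting with an irreducible representation is a scalar. -/
theorem exists_eq_smul_of_commute [FiniteDimensional ℂ V] (ρ : Representation ℂ G V)
    (hρ : ρ.IsIrreducible) (T : V →ₗ[ℂ] V) (hT : ∀ g, T ∘ₗ ρ g = ρ g ∘ₗ T) : ∃ c : ℂ, T = c • LinearMap.id := by
  let f : IntertwiningMap ρ ρ := ⟨T, hT⟩
  obtain ⟨c, hc⟩ :=
    (IsIrreducible.algebraMap_intertwiningMap_bijective_of_isAlgClosed (ρ := ρ)).surjective f
  refine ⟨c, ?_⟩
  rw [Algebra.algebraMap_eq_smul_one] at hc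
  exact (congrArg IntertwiningMap.toLinearMap hc).symm

theorem nontrivial_of_isIrreducible (ρ : Representation ℂ G V) (hρ : ρ.IsIrreducible) :
    Nontrivial V := by
  by_contra h
  rw [not_nontrivial_iff_subsingleton] at h
  refine hρ.bot_ne_top (SetLike.ext fun v => ?_)
  rw [Subsingleton.elim v 0]
  exact iff_of_true (Submodule.zero_mem (⊥ : Subrepresentation ρ).toSubmodule)
    (Submodule.zero_mem (⊤ : Subrepresentation ρ).toSubmodule)

/-- Irreducibility only depends on the lattice of invariant subspaces. -/
theorem isIrreducible_of_mem_iff {G' V' : Type*} [Group G'] [AddCommGroup V'] [Module ℂ V']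
    (ρ : Representation ℂ G V) (σ : Representation ℂ G' V') (e : V ≃ₗ[ℂ] V')
    (h₁ : ∀ g, ∃ g', ∀ v, e (ρ g v) = σ g' (e v)) (h₂ : ∀ g', ∃ g, ∀ v, e (ρ g v) = σ g' (e v))
    (hρ : ρ.IsIrreducible) : σ.IsIrreducible := by
  let F : Subrepresentation σ ≃o Subrepresentation ρ :=
    { toFun := fun W => ⟨W.toSubmodule.comap e.toLinearMap, fun g v hv => by
        obtain ⟨g', hg'⟩ := h₁ g
        change e (ρ g v) ∈ W.toSubmodule
        rw [hg']
        exact W.apply_mem_toSubmodule g' hv⟩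
      invFun := fun W => ⟨W.toSubmodule.comap e.symm.toLinearMap, fun g' v hv => by
        obtain ⟨g, hg⟩ := h₂ g'
        change e.symm (σ g' v) ∈ W.toSubmodule
        have : e.symm (σ g' v) = ρ g (e.symm v) := by
          rw [LinearEquiv.symm_apply_eq, hg, LinearEquiv.apply_symm_apply]
        rw [this]
        exact W.apply_mem_toSubmodule g hv⟩
      left_inv := fun W => by
        refine Subrepresentation.toSubmodule_injective (Submodule.ext fun v => ?_)
        change e (e.symm v) ∈ W.toSubmodule ↔ _
        rw [LinearEquiv.apply_symm_apply]
      right_inv := fun W => by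
        refine Subrepresentation.toSubmodule_injective (Submodule.ext fun v => ?_)
        change e.symm (e v) ∈ W.toSubmodule ↔ _
        rw [LinearEquiv.symm_apply_apply]
      map_rel_iff' := by
        intro A B
        refine ⟨fun h v hv => ?_, fun h v hv => h hv⟩
        have := @h (e.symm v)
        change e (e.symm v) ∈ A.toSubmodule → e (e.symm v) ∈ B.toSubmodule at this
        rw [LinearEquiv.apply_symm_apply] at this
        exact this hv }
  exact F.isSimpleOrder_iff.mpr hρ

variable [FiniteDimensional ℂ V]

/-- A choice of basis transports the representation to the coordinate space required by `irrChar`.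
-/
theorem character_mem_irrChar (ρ : Representation ℂ G V) (hρ : ρ.IsIrreducible) :
    ρ.character ∈ irrChar G := by
  let e : V ≃ₗ[ℂ] (Fin (finrank ℂ V) → ℂ) := (finBasis ℂ V).equivFun
  let σ : Representation ℂ G (Fin (finrank ℂ V) → ℂ) :=
    { toFun := fun g => e.conj (ρ g)
      map_one' := by rw [map_one]; exact e.conj_id
      map_mul' := fun a b => by rw [map_mul]; exact e.conj_comp _ _ }
  have hσ : ∀ g v, e (ρ g v) = σ g (e v) := fun g v => by
    change _ = e.conj (ρ g) (e v)
    rw [LinearEquiv.conj_apply_apply, LinearEquiv.symm_apply_apply]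
  refine ⟨_, σ, isIrreducible_of_mem_iff ρ σ e (fun g => ⟨g, hσ g⟩) (fun g => ⟨g, hσ g⟩) hρ, ?_⟩
  ext g
  exact LinearMap.trace_conj' (ρ g) e

variable [Fintype G]

/-- A representation whose character has norm one is irreducible. -/
theorem isIrreducible_of_norm_one (ρ : Representation ℂ G V)
    (h : (Nat.card G : ℂ)⁻¹ * ∑ g, ρ.character g * ρ.character g⁻¹ = 1) : ρ.IsIrreducible := by
  have hcard : (Nat.card G : ℂ) ≠ 0 := Nat.cast_ne_zero.mpr Nat.card_pos.ne'
  let _ : Invertible (Nat.card G : ℂ) := invertibleOfNonzero hcard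
  have : NeZero (Nat.card G : ℂ) := ⟨hcard⟩
  -- The norm of the character is the dimension of the space of self-intertwiners, so all of these
  -- are scalars.
  rw [card_inv_mul_sum_char_mul_char_eq_finrank] at h
  have h1 : finrank ℂ (IntertwiningMap ρ ρ) = 1 := by exact_mod_cast h
  have hone : (1 : IntertwiningMap ρ ρ) ≠ 0 := by
    intro h0
    have : Subsingleton (IntertwiningMap ρ ρ) := ⟨fun a b => by
      rw [← mul_one a, ← mul_one b, h0, mul_zero, mul_zero]⟩
    rw [finrank_zero_of_subsingleton] at h1
    exact zero_ne_one h1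
  have hscal := (finrank_eq_one_iff_of_nonzero' _ hone).mp h1
  have hbt : (⊥ : Subrepresentation ρ) ≠ ⊤ := by
    intro hbt
    refine hone (IntertwiningMap.ext (LinearMap.ext fun v => ?_))
    have : v ∈ (⊥ : Subrepresentation ρ) := by rw [hbt]; exact Submodule.mem_top
    exact (Submodule.mem_bot ℂ).mp this
  refine { exists_pair_ne := ⟨_, _, hbt⟩, eq_bot_or_eq_top := fun W => ?_ }
  -- By Maschke, `W` has an invariant complement. The projection onto `W` along it is equivariant,
  -- hence a scalar `c`; then `W` is zero or everything according to whether `c = 0`.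
  obtain ⟨W', hW⟩ := exists_isCompl W
  have hc : IsCompl W.toSubmodule W'.toSubmodule := by
    refine IsCompl.of_eq ?_ ?_
    · exact congrArg Subrepresentation.toSubmodule hW.inf_eq_bot
    · exact congrArg Subrepresentation.toSubmodule hW.sup_eq_top
  let P : V →ₗ[ℂ] V := W.toSubmodule.subtype ∘ₗ Submodule.projectionOnto _ _ hc
  have hPW : ∀ v ∈ W.toSubmodule, P v = v := fun v hv => by
    change ((Submodule.projectionOnto _ _ hc v : W.toSubmodule) : V) = v
    rw [Submodule.projectionOnto_apply_left hc ⟨v, hv⟩]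
  have hPW' : ∀ v ∈ W'.toSubmodule, P v = 0 := fun v hv => by
    change ((Submodule.projectionOnto _ _ hc v : W.toSubmodule) : V) = 0
    rw [Submodule.projectionOnto_apply_of_mem_right hc hv]; rfl
  have hcomm : ∀ g, P ∘ₗ ρ g = ρ g ∘ₗ P := by
    intro g
    ext v
    obtain ⟨w, hw, w', hw', rfl⟩ := Submodule.mem_sup.mp
      (show v ∈ W.toSubmodule ⊔ W'.toSubmodule by rw [hc.sup_eq_top]; trivial)
    simp only [LinearMap.comp_apply, map_add]
    rw [hPW _ hw, hPW' _ hw', hPW _ (W.apply_mem_toSubmodule g hw),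
      hPW' _ (W'.apply_mem_toSubmodule g hw'), map_zero]
  obtain ⟨c, hc'⟩ := hscal ⟨P, hcomm⟩
  have hP : ∀ v, P v = c • v := fun v =>
    (congrArg (fun f : IntertwiningMap ρ ρ => f v) hc').symm
  by_cases hc0 : c = 0
  · left
    refine Subrepresentation.toSubmodule_injective ((Submodule.eq_bot_iff _).mpr fun v hv => ?_)
    rw [← hPW v hv, hP, hc0, zero_smul]
  · right
    refine Subrepresentation.toSubmodule_injective (Submodule.eq_top_iff'.mpr fun v => ?_)
    have : v = c⁻¹ • P v := by rw [hP, smul_smul, inv_mul_cancel₀ hc0, one_smul]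
    rw [this]
    exact Submodule.smul_mem _ _ (Subtype.mem _)

/-- A class function orthogonal to all irreducible characters acts as zero in every
representation. -/
theorem sum_smul_eq_zero_of_orthogonal (f : G → ℂ) (hf : ∀ g h, f (h * g * h⁻¹) = f g)
    (hort : ∀ χ ∈ irrChar G, ∑ g, f g * χ g⁻¹ = 0) (n : ℕ) :
    ∀ {V : Type*} [AddCommGroup V] [Module ℂ V] [FiniteDimensional ℂ V]
      (ρ : Representation ℂ G V), finrank ℂ V = n → ∀ v, ∑ g, f g • ρ g⁻¹ v = 0 := by
  have : NeZero (Nat.card G : ℂ) := ⟨Nat.cast_ne_zero.mpr Nat.card_pos.ne'⟩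
  induction n using Nat.strong_induction_on with
  | _ n ih =>
  intro V _ _ _ ρ hn v
  by_cases hirr : ρ.IsIrreducible
  · have hV := nontrivial_of_isIrreducible ρ hirr
    let T : V →ₗ[ℂ] V := ∑ g, f g • ρ g⁻¹
    have hT : ∀ h, T ∘ₗ ρ h = ρ h ∘ₗ T := by
      intro h
      ext w
      simp only [T, LinearMap.comp_apply, LinearMap.sum_apply, LinearMap.smul_apply, map_sum,
        map_smul]
      refine Fintype.sum_equiv (MulAut.conj h⁻¹).toEquiv _ _ fun g => ?_
      change _ = f (h⁻¹ * g * h⁻¹⁻¹) • ρ h (ρ (h⁻¹ * g * h⁻¹⁻¹)⁻¹ w)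
      rw [hf, ← Module.End.mul_apply, ← Module.End.mul_apply, ← map_mul, ← map_mul]
      congr 3
      group
    obtain ⟨c, hc⟩ := exists_eq_smul_of_commute ρ hirr T hT
    -- The trace of the scalar `T` is the pairing of `f` with the character, and it is also `c`
    -- times a nonzero dimension; so `c = 0`.
    have htr : LinearMap.trace ℂ V T = 0 := by
      simp only [T, map_sum, map_smul, smul_eq_mul]
      exact hort _ (character_mem_irrChar ρ hirr)
    rw [hc, map_smul, LinearMap.trace_id, smul_eq_mul, mul_eq_zero] at htr
    have hc0 : c = 0 := htr.resolve_right (Nat.cast_ne_zero.mpr finrank_pos.ne')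
    have : T v = 0 := by rw [hc, hc0, zero_smul, LinearMap.zero_apply]
    simpa [T, LinearMap.sum_apply] using this
  · by_cases hbt : (⊥ : Subrepresentation ρ) = ⊤
    · have hv : v ∈ (⊥ : Subrepresentation ρ) := by rw [hbt]; exact Submodule.mem_top
      rw [(Submodule.mem_bot ℂ).mp hv]
      simp
    · obtain ⟨W, hW⟩ : ∃ W : Subrepresentation ρ, ¬ (W = ⊥ ∨ W = ⊤) := by
        by_contra! hcon
        exact hirr { exists_pair_ne := ⟨_, _, hbt⟩, eq_bot_or_eq_top := hcon }
      rw [not_or] at hW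
      -- Maschke splits a reducible representation into two proper summands, to which the induction
      -- on dimension applies.
      obtain ⟨W', hc⟩ := exists_isCompl W
      have key : ∀ U : Subrepresentation ρ, U ≠ ⊤ → ∀ u ∈ U.toSubmodule,
          ∑ g, f g • ρ g⁻¹ u = 0 := by
        intro U hU u hu
        have hlt : finrank ℂ U.toSubmodule < n := by
          rw [← hn]
          exact Submodule.finrank_lt fun h => hU (Subrepresentation.toSubmodule_injective h)
        have := congrArg Subtype.val (ih _ hlt U.toRepresentation rfl ⟨u, hu⟩)
        simpa using! this
      have hW' : W' ≠ ⊤ := by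
        rintro rfl
        exact hW.1 (hc.disjoint.eq_bot_of_le le_top)
      have hsup : W.toSubmodule ⊔ W'.toSubmodule = ⊤ :=
        congrArg Subrepresentation.toSubmodule hc.sup_eq_top
      obtain ⟨w, hw, w', hw', rfl⟩ := Submodule.mem_sup.mp
        (show v ∈ W.toSubmodule ⊔ W'.toSubmodule by rw [hsup]; trivial)
      simp only [map_add, smul_add, Finset.sum_add_distrib]
      rw [key W hW.2 w hw, key W' hW' w' hw', add_zero]

/-- The irreducible characters are complete: a class function orthogonal to all of them is zero. -/
theorem eq_zero_of_orthogonal (f : G → ℂ) (hf : ∀ g h, f (h * g * h⁻¹) = f g)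
    (hort : ∀ χ ∈ irrChar G, ∑ g, f g * χ g⁻¹ = 0) : f = 0 := by
  let ρ : Representation ℂ G (G → ℂ) :=
    { toFun := fun g => LinearMap.funLeft ℂ ℂ (fun x => g⁻¹ * x)
      map_one' := by ext; simp [LinearMap.funLeft_apply]
      map_mul' := fun a b => by ext; simp [LinearMap.funLeft_apply, mul_assoc] }
  classical
  -- In the regular representation, `f` acts on the delta function at `1` by producing the function
  -- `x ↦ f x⁻¹`, so evaluation at `x⁻¹` recovers `f x`.
  have h := sum_smul_eq_zero_of_orthogonal f hf hort _ ρ rfl (Pi.single 1 1)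
  ext x
  have hx := congrFun h x⁻¹
  simp only [Finset.sum_apply, Pi.smul_apply, smul_eq_mul, Pi.zero_apply] at hx
  rw [Finset.sum_eq_single x] at hx
  · simpa [ρ, LinearMap.funLeft_apply] using! hx
  · intro g _ hg
    have : g⁻¹⁻¹ * x⁻¹ ≠ 1 := by
      rw [inv_inv, ne_eq, mul_inv_eq_one]; exact hg
    change f g * (Pi.single 1 1 : G → ℂ) (g⁻¹⁻¹ * x⁻¹) = 0
    rw [Pi.single_eq_of_ne this, mul_zero]
  · simp

end Representations

/-! ### Degrees, orthogonality and central elements -/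

section IrrChar

variable {G : Type*} [Group G]

theorem irrChar_conj {χ : G → ℂ} (hχ : χ ∈ irrChar G) (g h : G) : χ (h * g * h⁻¹) = χ g := by
  obtain ⟨n, ρ, _, rfl⟩ := hχ
  exact ρ.char_conj g h

theorem irrChar_one_ne_zero {χ : G → ℂ} (hχ : χ ∈ irrChar G) : χ 1 ≠ 0 := by
  obtain ⟨n, ρ, hρ, rfl⟩ := hχ
  have := nontrivial_of_isIrreducible ρ hρ
  rw [char_one]
  exact Nat.cast_ne_zero.mpr finrank_pos.ne'

/-- First orthogonality relation. -/
theorem irrChar_orthonormal [Fintype G] {χ ψ : G → ℂ} [Decidable (χ = ψ)] (hχ : χ ∈ irrChar G)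
    (hψ : ψ ∈ irrChar G) :
    (Nat.card G : ℂ)⁻¹ * ∑ g, χ g * ψ g⁻¹ = if χ = ψ then 1 else 0 := by
  classical
  have hcard : (Nat.card G : ℂ) ≠ 0 := Nat.cast_ne_zero.mpr Nat.card_pos.ne'
  let _ : Invertible (Nat.card G : ℂ) := invertibleOfNonzero hcard
  obtain ⟨n, ρ, hρ, rfl⟩ := hχ
  obtain ⟨m, σ, hσ, rfl⟩ := hψ
  have key1 := char_orthonormal ρ ρ
  rw [if_pos ⟨Representation.Equiv.refl ρ⟩] at key1
  by_cases h : ρ.character = σ.character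
  · rw [if_pos h, ← h, key1]
  · rw [if_neg h, char_orthonormal ρ σ, if_neg]
    rintro ⟨e⟩
    exact h (char_iso e).symm

/-- By Schur's lemma `z` acts as a scalar, and evaluating at `1` identifies it as `χ z / χ 1`. -/
theorem irrChar_center_mul {χ : G → ℂ} (hχ : χ ∈ irrChar G) {z : G} (hz : z ∈ Subgroup.center G)
    (g : G) : χ (z * g) = χ z / χ 1 * χ g := by
  have h1 := irrChar_one_ne_zero hχ
  obtain ⟨n, ρ, hρ, rfl⟩ := hχ
  obtain ⟨c, hc⟩ := exists_eq_smul_of_commute ρ hρ (ρ z) fun g => by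
    rw [← Module.End.mul_eq_comp, ← Module.End.mul_eq_comp, ← map_mul, ← map_mul,
      Subgroup.mem_center_iff.mp hz g]
  have key : ∀ g, ρ.character (z * g) = c * ρ.character g := fun g => by
    rw [character, map_mul, hc, Module.End.mul_eq_comp, LinearMap.smul_comp, map_smul,
      LinearMap.id_comp, smul_eq_mul, character]
  rw [key g, ← mul_one z, key 1, mul_div_assoc, div_self h1, mul_one]

end IrrChar

/-! ### Fixed and free conjugacy classes -/

section Classes

variable {G : Type*} [Group G] {Z : Subgroup G} (hZ : Z ≤ Subgroup.center G)

theorem mem_ann_mk {z g : G} : z ∈ ann Z hZ (ConjClasses.mk g) ↔ z ∈ Z ∧ IsConj (z * g) g := by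
  let _ := centralAction Z hZ
  constructor
  · rintro ⟨w, hw, rfl⟩
    exact ⟨w.2, ConjClasses.mk_eq_mk_iff_isConj.mp hw⟩
  · rintro ⟨hz, h⟩
    exact ⟨⟨z, hz⟩, ConjClasses.mk_eq_mk_iff_isConj.mpr h, rfl⟩

theorem ann_le (K : ConjClasses G) : ann Z hZ K ≤ Z := by
  rintro _ ⟨w, _, rfl⟩
  exact w.2

theorem ann_eq_bot_or_eq {p : ℕ} (hp : p.Prime) (hcard : Nat.card Z = p) (K : ConjClasses G) :
    ann Z hZ K = ⊥ ∨ ann Z hZ K = Z := by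
  have : Finite Z := Nat.finite_of_card_ne_zero (by rw [hcard]; exact hp.ne_zero)
  have hdvd : Nat.card (ann Z hZ K) ∣ p := hcard ▸ Subgroup.card_dvd_of_le (ann_le hZ K)
  rcases (Nat.dvd_prime hp).mp hdvd with h | h
  · exact Or.inl (Subgroup.card_eq_one.mp h)
  · exact Or.inr (Subgroup.eq_of_le_of_card_ge (ann_le hZ K) (by rw [hcard, h]))

theorem ne_bot_of_prime_card {p : ℕ} (hp : p.Prime) (hcard : Nat.card Z = p) : Z ≠ ⊥ := by
  rintro rfl
  rw [Subgroup.card_bot] at hcard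
  exact hp.one_lt.ne hcard

theorem orbit_eq_singleton_of_ann_eq (K : ConjClasses G) (h : ann Z hZ K = Z) :
    letI := centralAction Z hZ
    MulAction.orbit Z K = {K} := by
  let _ := centralAction Z hZ
  ext K'
  constructor
  · rintro ⟨z, rfl⟩
    have : (z : G) ∈ ann Z hZ K := h.ge z.2
    obtain ⟨w, hw, hwz⟩ := this
    rw [← Subtype.ext hwz]
    exact hw
  · rintro rfl
    exact MulAction.mem_orbit_self _

theorem card_orbit_of_ann_eq_bot [Finite G] (K : ConjClasses G) (h : ann Z hZ K = ⊥) :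
    letI := centralAction Z hZ
    Nat.card (MulAction.orbit Z K) = Nat.card Z := by
  let _ := centralAction Z hZ
  have hs : MulAction.stabilizer Z K = ⊥ :=
    (Subgroup.map_eq_bot_iff_of_injective _ Z.subtype_injective).mp h
  rw [Nat.card_coe_set_eq, ← MulAction.index_stabilizer, hs, Subgroup.index_bot]

/-- A central factor cancels from the conjugacy equation; being fixed or free is therefore a
property of the whole orbit. -/
theorem ann_smul (K : ConjClasses G) (z : Z) :
    letI := centralAction Z hZ
    ann Z hZ (z • K) = ann Z hZ K := by
  let _ := centralAction Z hZ
  obtain ⟨g, rfl⟩ := ConjClasses.mk_surjective K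
  ext w
  change w ∈ ann Z hZ (ConjClasses.mk ((z : G) * g)) ↔ _
  rw [mem_ann_mk, mem_ann_mk]
  refine and_congr_right fun _ => ?_
  have hz := Subgroup.mem_center_iff.mp (hZ z.2)
  simp only [isConj_iff]
  refine exists_congr fun c => ?_
  rw [show c * (w * (z * g)) * c⁻¹ = z * (c * (w * g) * c⁻¹) by
    simp only [← mul_assoc]; rw [hz (c * w)]; simp only [← mul_assoc], mul_right_inj]

/-- Orbits of fixed classes are singletons, so counting orbits amounts to counting classes. -/
theorem card_ann_eq_top [Finite G] :
    Nat.card {K : ConjClasses G // ann Z hZ K = Z} = orbitCount Z hZ Z := by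
  let _ := centralAction Z hZ
  refine Nat.card_congr (Equiv.ofBijective
    (fun K => (⟨MulAction.orbit Z K.1, K.1, K.2, rfl⟩ : orbitsWithAnn Z hZ Z)) ⟨?_, ?_⟩)
  · rintro ⟨K, hK⟩ ⟨K', hK'⟩ h
    have h' : MulAction.orbit Z K = MulAction.orbit Z K' := congrArg Subtype.val h
    rw [orbit_eq_singleton_of_ann_eq hZ K hK, orbit_eq_singleton_of_ann_eq hZ K' hK'] at h'
    exact Subtype.ext (Set.singleton_injective h')
  · rintro ⟨O, K, hK, rfl⟩
    exact ⟨⟨K, hK⟩, rfl⟩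

theorem card_ann_eq_bot [Finite G] :
    Nat.card {K : ConjClasses G // ann Z hZ K = ⊥} = Nat.card Z * orbitCount Z hZ ⊥ := by
  classical
  let _ := centralAction Z hZ
  let F : {K : ConjClasses G // ann Z hZ K = ⊥} → orbitsWithAnn Z hZ ⊥ :=
    fun K => ⟨MulAction.orbit Z K.1, K.1, K.2, rfl⟩
  have : Finite (orbitsWithAnn Z hZ ⊥) := Set.toFinite _
  have := Fintype.ofFinite (orbitsWithAnn Z hZ ⊥)
  rw [Nat.card_congr (Equiv.sigmaFiberEquiv F).symm, Nat.card_sigma, orbitCount,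
    ← Nat.card_coe_set_eq, mul_comm, Nat.card_eq_fintype_card (α := orbitsWithAnn Z hZ ⊥)]
  refine (Finset.sum_congr rfl ?_).trans (Finset.sum_const (Nat.card Z))
  rintro ⟨O, K, hK, rfl⟩ -
  rw [← card_orbit_of_ann_eq_bot hZ K hK]
  refine Nat.card_congr ⟨fun x => ⟨x.1.1, ?_⟩, fun y => ⟨⟨y.1, ?_⟩, ?_⟩, fun x => rfl, fun y => rfl⟩
  · exact MulAction.orbit_eq_iff.mp (congrArg Subtype.val x.2)
  · obtain ⟨z, hz⟩ := y.2
    rw [← hz]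
    exact (ann_smul hZ K z).trans hK
  · exact Subtype.ext (MulAction.orbit_eq_iff.mpr y.2)

theorem card_conjClasses [Finite G] {p : ℕ} (hp : p.Prime) (hcard : Nat.card Z = p) :
    Nat.card (ConjClasses G) = p * orbitCount Z hZ ⊥ + orbitCount Z hZ Z := by
  classical
  rw [← card_ann_eq_top hZ, ← hcard, ← card_ann_eq_bot hZ, ← Nat.card_sum]
  refine Nat.card_congr ((Equiv.sumCompl fun K => ann Z hZ K = ⊥).symm.trans
    (Equiv.sumCongr (Equiv.refl _) (Equiv.subtypeEquivRight fun K => ?_)))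
  refine ⟨fun h => (ann_eq_bot_or_eq hZ hp hcard K).resolve_left h, fun h h' => ?_⟩
  exact ne_bot_of_prime_card hp hcard (h.symm.trans h')

end Classes

/-! ### Central characters -/

section CentralCharacter

variable {G : Type*} [Group G]

/-- The character by which a central subgroup acts in an irreducible representation. -/
noncomputable def centralCharacter (Z : Subgroup G) (hZ : Z ≤ Subgroup.center G) (χ : irrChar G) :
    Z →* ℂ where
  toFun z := χ.1 z / χ.1 1
  map_one' := div_self (irrChar_one_ne_zero χ.2)
  map_mul' z w := by
    rw [Subgroup.coe_mul, irrChar_center_mul χ.2 (hZ z.2)]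
    ring

theorem irrChar_mul_eq {Z : Subgroup G} (hZ : Z ≤ Subgroup.center G) (χ : irrChar G) (z : Z)
    (g : G) : χ.1 (z * g) = centralCharacter Z hZ χ z * χ.1 g :=
  irrChar_center_mul χ.2 (hZ z.2) g

instance irrChar.finite [Finite G] : Finite (irrChar G) := (irrChar_finite G).to_subtype

/-- An irreducible character as a function on conjugacy classes. -/
def classChar (χ : irrChar G) : ConjClasses G → ℂ :=
  Quotient.lift χ.1 fun a b hab => by
    obtain ⟨c, rfl⟩ := isConj_iff.mp hab
    exact (irrChar_conj χ.2 a c).symm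

variable [Finite G]

theorem linearIndependent_classChar :
    LinearIndependent ℂ (classChar : irrChar G → ConjClasses G → ℂ) := by
  classical
  have := Fintype.ofFinite G
  have := Fintype.ofFinite (irrChar G)
  rw [Fintype.linearIndependent_iff]
  intro c hc ψ
  have h : ∀ g, ∑ χ, c χ * χ.1 g = 0 := fun g => by
    simpa [classChar] using! congrFun hc (ConjClasses.mk g)
  calc c ψ = ∑ χ, c χ * if χ.1 = ψ.1 then 1 else 0 := by
        simp [Subtype.val_inj]
    _ = ∑ χ, c χ * ((Nat.card G : ℂ)⁻¹ * ∑ g, χ.1 g * ψ.1 g⁻¹) :=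
        Finset.sum_congr rfl fun χ _ => by rw [irrChar_orthonormal χ.2 ψ.2]
    _ = (Nat.card G : ℂ)⁻¹ * ∑ g, (∑ χ, c χ * χ.1 g) * ψ.1 g⁻¹ := by
        simp only [Finset.mul_sum, Finset.sum_mul]
        rw [Finset.sum_comm]
        refine Finset.sum_congr rfl fun g _ => Finset.sum_congr rfl fun χ _ => by ring
    _ = 0 := by simp [h]

theorem span_classChar : ⊤ ≤ Submodule.span ℂ (Set.range (classChar (G := G))) := by
  classical
  have := Fintype.ofFinite G
  have := Fintype.ofFinite (irrChar G)
  intro f _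
  -- These are the Fourier coefficients of `f`: subtracting the corresponding combination leaves a
  -- class function orthogonal to every irreducible character, hence zero.
  let c : irrChar G → ℂ := fun χ => (Nat.card G : ℂ)⁻¹ * ∑ g, f (ConjClasses.mk g) * χ.1 g⁻¹
  have hcard : (Nat.card G : ℂ) ≠ 0 := Nat.cast_ne_zero.mpr Nat.card_pos.ne'
  have key : (fun g : G => f (ConjClasses.mk g) - ∑ χ, c χ * χ.1 g) = 0 := by
    refine eq_zero_of_orthogonal _ (fun g h => ?_) fun ψ hψ => ?_
    · have : ConjClasses.mk (h * g * h⁻¹) = ConjClasses.mk g :=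
        ConjClasses.mk_eq_mk_iff_isConj.mpr (isConj_iff.mpr ⟨h, rfl⟩).symm
      rw [this]
      simp only [irrChar_conj (Subtype.mem _)]
    · have h1 : ∑ g, (∑ χ, c χ * χ.1 g) * ψ g⁻¹ = Nat.card G * c ⟨ψ, hψ⟩ := by
        have : ∀ χ : irrChar G, ∑ g, χ.1 g * ψ g⁻¹ = Nat.card G * if χ.1 = ψ then 1 else 0 := by
          intro χ
          rw [← irrChar_orthonormal χ.2 hψ, mul_inv_cancel_left₀ hcard]
        simp only [Finset.sum_mul]
        rw [Finset.sum_comm]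
        simp only [mul_assoc, ← Finset.mul_sum, this]
        rw [Finset.sum_eq_single ⟨ψ, hψ⟩]
        · simp [mul_comm]
        · intro χ _ hχ
          rw [if_neg fun h => hχ (Subtype.ext h), mul_zero, mul_zero]
        · simp
      simp only [sub_mul, Finset.sum_sub_distrib]
      rw [h1, mul_inv_cancel_left₀ hcard, sub_self]
  have hf : f = ∑ χ, c χ • classChar χ := by
    ext K
    obtain ⟨g, rfl⟩ := ConjClasses.mk_surjective K
    have := congrFun key g
    rw [Pi.zero_apply, sub_eq_zero] at this
    rw [this, Finset.sum_apply]
    rfl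
  rw [hf]
  exact Submodule.sum_mem _ fun χ _ => Submodule.smul_mem _ _ (Submodule.subset_span ⟨χ, rfl⟩)

variable {Z : Subgroup G} (hZ : Z ≤ Subgroup.center G)

/-- The trace of a central element on the space of class functions, computed in the basis of
irreducible characters and in the basis of indicator functions. -/
theorem sum_centralCharacter [Fintype (irrChar G)] (z : Z) :
    ∑ χ, centralCharacter Z hZ χ z = Nat.card {K : ConjClasses G // (z : G) ∈ ann Z hZ K} := by
  classical
  let _ := centralAction Z hZ
  have := Fintype.ofFinite (ConjClasses G)
  let T : (ConjClasses G → ℂ) →ₗ[ℂ] (ConjClasses G → ℂ) :=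
    LinearMap.funLeft ℂ ℂ (fun K => z • K)
  let b := Basis.mk (linearIndependent_classChar (G := G)) span_classChar
  have h1 : LinearMap.trace ℂ _ T = ∑ χ, centralCharacter Z hZ χ z := by
    rw [LinearMap.trace_eq_matrix_trace ℂ b, Matrix.trace]
    refine Finset.sum_congr rfl fun χ _ => ?_
    have : T (b χ) = centralCharacter Z hZ χ z • b χ := by
      rw [Basis.mk_apply]
      ext K
      obtain ⟨g, rfl⟩ := ConjClasses.mk_surjective K
      exact irrChar_mul_eq hZ χ z g
    rw [Matrix.diag_apply, LinearMap.toMatrix_apply, this, map_smul, Basis.repr_self]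
    simp
  have h2 : LinearMap.trace ℂ _ T = ∑ K : ConjClasses G, if z • K = K then 1 else 0 := by
    rw [LinearMap.trace_eq_matrix_trace ℂ (Pi.basisFun ℂ _), Matrix.trace]
    refine Finset.sum_congr rfl fun K _ => ?_
    rw [Matrix.diag_apply, LinearMap.toMatrix_apply]
    simp [T, LinearMap.funLeft_apply, Pi.single_apply]
  rw [← h1, h2, Finset.sum_boole, Nat.card_eq_fintype_card, Fintype.card_subtype]
  congr 2
  ext K
  simp only [Finset.mem_filter_univ]
  refine ⟨fun h => ⟨z, h, rfl⟩, ?_⟩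
  rintro ⟨w, hw, hwz⟩
  rw [← Subtype.ext hwz]
  exact hw

/-- The number of irreducible characters lying over a linear character of a central subgroup of
prime order. -/
theorem card_centralCharacter_eq {p : ℕ} (hp : p.Prime) (hcard : Nat.card Z = p) (l : Z →* ℂ)
    [Decidable (l = 1)] :
    Nat.card {χ : irrChar G // centralCharacter Z hZ χ = l} =
      orbitCount Z hZ ⊥ + if l = 1 then orbitCount Z hZ Z else 0 := by
  classical
  have := Fintype.ofFinite (irrChar G)
  have := Fintype.ofFinite Z
  have hcard' : Fintype.card Z = p := by rw [← Nat.card_eq_fintype_card, hcard]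
  have hp0 : (p : ℂ) ≠ 0 := Nat.cast_ne_zero.mpr hp.ne_zero
  -- The identity fixes all classes. Any other `z` fixes only the classes fixed by all of `Z`,
  -- because an annihilator is trivial or equal to `Z`.
  have hfix : ∀ z : Z, (Nat.card {K : ConjClasses G // (z : G) ∈ ann Z hZ K} : ℂ) =
      (if z = 1 then (p : ℂ) * orbitCount Z hZ ⊥ else 0) + orbitCount Z hZ Z := by
    intro z
    split_ifs with hz
    · rw [Nat.card_congr (Equiv.subtypeUnivEquiv fun K => by rw [hz]; exact Subgroup.one_mem _),
        card_conjClasses hZ hp hcard]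
      push_cast; ring
    · rw [zero_add, ← card_ann_eq_top hZ]
      congr 1
      refine Nat.card_congr (Equiv.subtypeEquivRight fun K => ⟨fun h => ?_, fun h => h.ge z.2⟩)
      refine (ann_eq_bot_or_eq hZ hp hcard K).resolve_left fun hb => hz ?_
      rw [hb, Subgroup.mem_bot] at h
      exact Subtype.ext h
  -- This is `m / l`; its sum over `Z` vanishes unless it is trivial, which is the orthogonality
  -- needed for Fourier inversion.
  let twist (m : Z →* ℂ) : Z →* ℂ :=
    { toFun := fun z => l z⁻¹ * m z
      map_one' := by simp
      map_mul' := fun a b => by rw [mul_inv_rev, map_mul, map_mul]; ring }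
  have htwist : ∀ m : Z →* ℂ, ∑ z, l z⁻¹ * m z = if m = l then (p : ℂ) else 0 := by
    intro m
    have hl : ∀ z, l z⁻¹ * l z = 1 := fun z => by rw [← map_mul, inv_mul_cancel, map_one]
    split_ifs with h
    · subst h
      simp only [hl, Finset.sum_const, Finset.card_univ, hcard', nsmul_eq_mul, mul_one]
    · refine sum_hom_units_eq_zero (twist m) fun h1 => h ?_
      ext z
      have h2 : l z⁻¹ * m z = 1 := DFunLike.congr_fun h1 z
      calc m z = l z⁻¹ * l z * m z := by rw [hl, one_mul]
        _ = (l z⁻¹ * m z) * l z := by ring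
        _ = l z := by rw [h2, one_mul]
  have hmain : (p : ℂ) * Nat.card {χ : irrChar G // centralCharacter Z hZ χ = l} =
      p * (orbitCount Z hZ ⊥ + if l = 1 then orbitCount Z hZ Z else 0 : ℕ) := by
    calc _ = ∑ χ, if centralCharacter Z hZ χ = l then (p : ℂ) else 0 := by
          rw [Nat.card_eq_fintype_card, Fintype.card_subtype, ← Finset.sum_filter,
            Finset.sum_const, nsmul_eq_mul, mul_comm]
      _ = ∑ χ, ∑ z, l z⁻¹ * centralCharacter Z hZ χ z := by simp only [htwist]
      _ = ∑ z, l z⁻¹ * ((if z = 1 then (p : ℂ) * orbitCount Z hZ ⊥ else 0) +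
            orbitCount Z hZ Z) := by
          rw [Finset.sum_comm]
          simp only [← Finset.mul_sum, sum_centralCharacter, hfix]
      _ = p * orbitCount Z hZ ⊥ + (∑ z, l z⁻¹ * (1 : Z →* ℂ) z) * orbitCount Z hZ Z := by
          simp only [mul_add, Finset.sum_add_distrib, Finset.sum_mul, MonoidHom.one_apply, mul_one]
          congr 1
          simp
      _ = _ := by
          rw [htwist]
          simp only [eq_comm (a := (1 : Z →* ℂ))]
          split_ifs <;> push_cast <;> ring
  exact_mod_cast mul_left_cancel₀ hp0 hmain

end CentralCharacter

/-! ### Class sizes in quotients by central subgroups of prime order -/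

section QuotientClasses

variable {G : Type*} [Group G] {Z : Subgroup G} (hZ : Z ≤ Subgroup.center G)

/-- Conjugacy modulo `Z` is conjugacy up to a factor in `Z`, so the fibres of the map on classes are
the `Z`-orbits. -/
theorem map_mk'_eq_iff [Z.Normal] (K K' : ConjClasses G) :
    letI := centralAction Z hZ
    ConjClasses.map (QuotientGroup.mk' Z) K' = ConjClasses.map (QuotientGroup.mk' Z) K ↔
      K' ∈ MulAction.orbit Z K := by
  let _ := centralAction Z hZ
  obtain ⟨g, rfl⟩ := ConjClasses.mk_surjective K
  obtain ⟨g', rfl⟩ := ConjClasses.mk_surjective K'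
  constructor
  · intro h
    obtain ⟨c, hc⟩ := isConj_iff.mp (ConjClasses.mk_eq_mk_iff_isConj.mp h)
    obtain ⟨c, rfl⟩ := QuotientGroup.mk'_surjective Z c
    rw [← map_inv, ← map_mul, ← map_mul, QuotientGroup.mk'_eq_mk'] at hc
    obtain ⟨z, hz, hc⟩ := hc
    refine ⟨⟨z⁻¹, Z.inv_mem hz⟩, ConjClasses.mk_eq_mk_iff_isConj.mpr (IsConj.symm ?_)⟩
    refine isConj_iff.mpr ⟨c, ?_⟩
    change _ = z⁻¹ * g
    rw [← hc, ← Subgroup.mem_center_iff.mp (hZ (Z.inv_mem hz)), mul_inv_cancel_right]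
  · rintro ⟨z, hz⟩
    have h1 : ConjClasses.mk (z * g) = ConjClasses.mk g' := hz
    rw [← h1]
    change ConjClasses.mk (QuotientGroup.mk' Z (z * g)) = ConjClasses.mk (QuotientGroup.mk' Z g)
    rw [map_mul, (QuotientGroup.eq_one_iff (z : G)).mpr z.2 |> fun h =>
      (show QuotientGroup.mk' Z (z : G) = 1 from h), one_mul]

theorem mem_carrier_mk {G : Type*} [Group G] {x g : G} :
    x ∈ (ConjClasses.mk g).carrier ↔ IsConj g x := Iff.rfl

theorem card_carrier_smul (K : ConjClasses G) (z : Z) :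
    letI := centralAction Z hZ
    Nat.card (z • K).carrier = Nat.card K.carrier := by
  let _ := centralAction Z hZ
  refine (Nat.card_congr ((Equiv.mulLeft (z : G)).subtypeEquiv fun x => ?_)).symm
  obtain ⟨g, rfl⟩ := ConjClasses.mk_surjective K
  change x ∈ (ConjClasses.mk g).carrier ↔ z * x ∈ (ConjClasses.mk (z * g)).carrier
  have hz := Subgroup.mem_center_iff.mp (hZ z.2)
  simp only [mem_carrier_mk, isConj_iff]
  refine exists_congr fun c => ?_
  rw [← mul_assoc c, hz c, mul_assoc (z : G), mul_assoc (z : G), mul_right_inj]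

/-- Both sides count the preimage in `G` of the image class: it is a union of cosets of `Z`, and
also the disjoint union of the classes `zK`, all of the same size. -/
theorem card_carrier_mul_card_orbit [Finite G] [Z.Normal] (K : ConjClasses G) :
    letI := centralAction Z hZ
    Nat.card K.carrier * Nat.card (MulAction.orbit Z K) =
      Nat.card Z * Nat.card (ConjClasses.map (QuotientGroup.mk' Z) K).carrier := by
  classical
  let _ := centralAction Z hZ
  have := Fintype.ofFinite (MulAction.orbit Z K)
  rw [← Nat.card_prod Z, ← Nat.card_congr (QuotientGroup.preimageMkEquivSubgroupProdSet Z _)]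
  let F : ((QuotientGroup.mk : G → G ⧸ Z) ⁻¹'
      (ConjClasses.map (QuotientGroup.mk' Z) K).carrier) → MulAction.orbit Z K :=
    fun x => ⟨ConjClasses.mk x.1, (map_mk'_eq_iff hZ K _).mp (ConjClasses.mem_carrier_iff_mk_eq.mp x.2)⟩
  rw [Nat.card_congr (Equiv.sigmaFiberEquiv F).symm, Nat.card_sigma, mul_comm,
    Nat.card_eq_fintype_card (α := MulAction.orbit Z K)]
  refine ((Finset.sum_congr rfl ?_).trans (Finset.sum_const (Nat.card K.carrier))).symm
  rintro ⟨_, z, rfl⟩ -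
  rw [← card_carrier_smul hZ K z]
  refine Nat.card_congr ⟨fun x => ⟨x.1.1, ?_⟩, fun y => ⟨⟨y.1, ?_⟩, ?_⟩, fun x => rfl, fun y => rfl⟩
  · exact ConjClasses.mem_carrier_iff_mk_eq.mpr (congrArg Subtype.val x.2)
  · have hy : ConjClasses.mk y.1 ∈ MulAction.orbit Z K := by
      rw [ConjClasses.mem_carrier_iff_mk_eq.mp y.2]
      exact ⟨z, rfl⟩
    exact ConjClasses.mem_carrier_iff_mk_eq.mpr
      ((map_mk'_eq_iff hZ K (ConjClasses.mk y.1)).mpr hy)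
  · exact Subtype.ext (ConjClasses.mem_carrier_iff_mk_eq.mp y.2)

open Classical in
-- The `p`-th power turns the product over classes of the quotient into one over classes of `G`: a
-- quotient class is hit either by `p` free classes or by one fixed class, which is then given
-- weight `p`. The identity is then checked one class at a time.
theorem prod_card_carrier_quotient [Finite G] [Fintype (ConjClasses G)] [Z.Normal]
    [Fintype (ConjClasses (G ⧸ Z))] {p : ℕ} (hp : p.Prime) (hcard : Nat.card Z = p) :
    p ^ (p * orbitCount Z hZ Z) * (∏ L : ConjClasses (G ⧸ Z), Nat.card L.carrier) ^ p =
      (∏ K : ConjClasses G with ann Z hZ K = Z, Nat.card K.carrier) ^ (p - 1) *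
        ∏ K : ConjClasses G, Nat.card K.carrier := by
  let _ := centralAction Z hZ
  set π : ConjClasses G → ConjClasses (G ⧸ Z) := ConjClasses.map (QuotientGroup.mk' Z) with hπ
  have hsurj : Function.Surjective π := ConjClasses.map_surjective (QuotientGroup.mk'_surjective Z)
  have hfix : ∀ K, ann Z hZ K = Z → Nat.card K.carrier = p * Nat.card (π K).carrier := by
    intro K hK
    have := card_carrier_mul_card_orbit hZ K
    rwa [orbit_eq_singleton_of_ann_eq hZ K hK, Nat.card_unique (α := ({K} : Set _)), mul_one,
      hcard] at this
  have hfree : ∀ K, ann Z hZ K ≠ Z → Nat.card K.carrier = Nat.card (π K).carrier := by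
    intro K hK
    have := card_carrier_mul_card_orbit hZ K
    rw [card_orbit_of_ann_eq_bot hZ K ((ann_eq_bot_or_eq hZ hp hcard K).resolve_right hK), hcard,
      mul_comm] at this
    exact Nat.eq_of_mul_eq_mul_left hp.pos this
  have hexp : ∀ L, ∑ K with π K = L, (if ann Z hZ K = Z then p else 1) = p := by
    intro L
    obtain ⟨K₀, rfl⟩ := hsurj L
    have hann : ∀ K ∈ Finset.univ.filter (fun K => π K = π K₀), ann Z hZ K = ann Z hZ K₀ := by
      intro K hK
      obtain ⟨z, rfl⟩ := (map_mk'_eq_iff hZ K₀ K).mp (Finset.mem_filter.mp hK).2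
      exact ann_smul hZ K₀ z
    have hc : (Finset.univ.filter (fun K => π K = π K₀)).card =
        Nat.card (MulAction.orbit Z K₀) := by
      rw [← Fintype.card_subtype, ← Nat.card_eq_fintype_card]
      exact Nat.card_congr (Equiv.subtypeEquivRight fun K => map_mk'_eq_iff hZ K₀ K)
    rw [Finset.sum_congr rfl fun K hK => by rw [hann K hK], Finset.sum_const, hc, smul_eq_mul]
    split_ifs with h
    · rw [orbit_eq_singleton_of_ann_eq hZ K₀ h, Nat.card_unique, one_mul]
    · rw [card_orbit_of_ann_eq_bot hZ K₀ ((ann_eq_bot_or_eq hZ hp hcard K₀).resolve_right h),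
        hcard, mul_one]
  have hQ : (∏ L : ConjClasses (G ⧸ Z), Nat.card L.carrier) ^ p =
      ∏ K, Nat.card (π K).carrier ^ (if ann Z hZ K = Z then p else 1) := by
    rw [← Finset.prod_pow, ← Finset.prod_fiberwise Finset.univ π]
    refine Finset.prod_congr rfl fun L _ => ?_
    rw [← hexp L, ← Finset.prod_pow_eq_pow_sum, hexp L]
    exact Finset.prod_congr rfl fun K hK => by rw [(Finset.mem_filter.mp hK).2]
  have hP : p ^ (p * orbitCount Z hZ Z) = ∏ K, if ann Z hZ K = Z then p ^ p else 1 := by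
    rw [← Finset.prod_filter, Finset.prod_const, ← card_ann_eq_top hZ, Nat.card_eq_fintype_card,
      Fintype.card_subtype, pow_mul]
  rw [hQ, hP, ← Finset.prod_pow, Finset.prod_filter, ← Finset.prod_mul_distrib,
    ← Finset.prod_mul_distrib]
  refine Finset.prod_congr rfl fun K _ => ?_
  split_ifs with h
  · rw [← mul_pow, ← hfix K h, ← pow_succ, Nat.sub_add_cancel hp.one_le]
  · rw [one_mul, one_mul, pow_one, hfree K h]

end QuotientClasses

/-! ### Direct products -/

section Product

variable {G₁ G₂ : Type*} [Group G₁] [Group G₂]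

theorem isConj_prod_iff {a c : G₁} {b d : G₂} :
    IsConj (a, b) (c, d) ↔ IsConj a c ∧ IsConj b d := by
  simp only [isConj_iff, Prod.exists, Prod.ext_iff]
  constructor
  · rintro ⟨x, y, h₁, h₂⟩
    exact ⟨⟨x, h₁⟩, ⟨y, h₂⟩⟩
  · rintro ⟨⟨x, h₁⟩, ⟨y, h₂⟩⟩
    exact ⟨x, y, h₁, h₂⟩

/-- Conjugacy classes of a direct product are pairs of conjugacy classes. -/
noncomputable def conjClassesProd (G₁ G₂ : Type*) [Group G₁] [Group G₂] :
    ConjClasses (G₁ × G₂) ≃ ConjClasses G₁ × ConjClasses G₂ :=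
  Equiv.ofBijective
    (fun K => (ConjClasses.map (MonoidHom.fst G₁ G₂) K, ConjClasses.map (MonoidHom.snd G₁ G₂) K))
    ⟨by
      intro K K' h
      obtain ⟨⟨a, b⟩, rfl⟩ := ConjClasses.mk_surjective K
      obtain ⟨⟨c, d⟩, rfl⟩ := ConjClasses.mk_surjective K'
      exact ConjClasses.mk_eq_mk_iff_isConj.mpr (isConj_prod_iff.mpr
        ⟨ConjClasses.mk_eq_mk_iff_isConj.mp (congrArg Prod.fst h),
          ConjClasses.mk_eq_mk_iff_isConj.mp (congrArg Prod.snd h)⟩), by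
      rintro ⟨K, K'⟩
      obtain ⟨a, rfl⟩ := ConjClasses.mk_surjective K
      obtain ⟨b, rfl⟩ := ConjClasses.mk_surjective K'
      exact ⟨ConjClasses.mk (a, b), rfl⟩⟩

theorem card_carrier_prod (K : ConjClasses (G₁ × G₂)) :
    Nat.card K.carrier = Nat.card (conjClassesProd G₁ G₂ K).1.carrier *
      Nat.card (conjClassesProd G₁ G₂ K).2.carrier := by
  obtain ⟨⟨a, b⟩, rfl⟩ := ConjClasses.mk_surjective K
  rw [← Nat.card_prod, ← Nat.card_congr (Equiv.Set.prod _ _)]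
  refine Nat.card_congr (Equiv.setCongr (Set.ext fun ⟨c, d⟩ => ?_))
  rw [mem_carrier_mk, isConj_prod_iff, Set.mem_prod]
  exact and_congr mem_carrier_mk.symm
    mem_carrier_mk.symm

variable {H₁ : Subgroup G₁} {H₂ : Subgroup G₂} (hH₁ : H₁ ≤ Subgroup.center G₁)
  (hH₂ : H₂ ≤ Subgroup.center G₂) (θ : H₁ ≃* H₂)

theorem centralProductKernel_le_center :
    centralProductKernel hH₁ hH₂ θ ≤ Subgroup.center (G₁ × G₂) := by
  rintro _ ⟨h, rfl⟩
  rw [Subgroup.mem_center_iff]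
  rintro ⟨x, y⟩
  exact Prod.ext (Subgroup.mem_center_iff.mp (hH₁ h.2) x)
    (Subgroup.mem_center_iff.mp (hH₂ (θ h⁻¹).2) y)

theorem card_centralProductKernel :
    Nat.card (centralProductKernel hH₁ hH₂ θ) = Nat.card H₁ := by
  refine (Nat.card_congr (Equiv.ofBijective
    (fun h : H₁ => (⟨((h : G₁), (θ h⁻¹ : G₂)), h, rfl⟩ : centralProductKernel hH₁ hH₂ θ))
    ⟨fun a b hab => ?_, ?_⟩)).symm
  · exact Subtype.ext (congrArg (fun x => x.1.1) hab)
  · rintro ⟨_, h, rfl⟩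
    exact ⟨h, rfl⟩

/-- Conjugacy in the product is componentwise, and the kernel projects onto all of `H₁` and, since
`θ` is surjective, onto all of `H₂`. -/
theorem ann_centralProductKernel_eq_iff (K : ConjClasses (G₁ × G₂)) :
    ann _ (centralProductKernel_le_center hH₁ hH₂ θ) K = centralProductKernel hH₁ hH₂ θ ↔
      ann H₁ hH₁ (conjClassesProd G₁ G₂ K).1 = H₁ ∧
        ann H₂ hH₂ (conjClassesProd G₁ G₂ K).2 = H₂ := by
  obtain ⟨⟨a, b⟩, rfl⟩ := ConjClasses.mk_surjective K
  change _ ↔ ann H₁ hH₁ (ConjClasses.mk a) = H₁ ∧ ann H₂ hH₂ (ConjClasses.mk b) = H₂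
  constructor
  · intro h
    have key : ∀ x : H₁, IsConj (x * a) a ∧ IsConj ((θ x⁻¹ : G₂) * b) b := fun x =>
      isConj_prod_iff.mp ((mem_ann_mk _).mp (h.ge ⟨x, rfl⟩)).2
    refine ⟨(ann_le hH₁ _).antisymm fun x hx => ?_, (ann_le hH₂ _).antisymm fun y hy => ?_⟩
    · exact (mem_ann_mk hH₁).mpr ⟨hx, (key ⟨x, hx⟩).1⟩
    · have := (key (θ.symm ⟨y, hy⟩)⁻¹).2
      rw [inv_inv, MulEquiv.apply_symm_apply] at this
      exact (mem_ann_mk hH₂).mpr ⟨hy, this⟩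
  · rintro ⟨h₁, h₂⟩
    refine (ann_le _ _).antisymm ?_
    rintro _ ⟨x, rfl⟩
    exact (mem_ann_mk _).mpr ⟨⟨x, rfl⟩, isConj_prod_iff.mpr
      ⟨((mem_ann_mk hH₁).mp (h₁.ge x.2)).2, ((mem_ann_mk hH₂).mp (h₂.ge (θ x⁻¹).2)).2⟩⟩

theorem orbitCount_centralProductKernel [Finite G₁] [Finite G₂] :
    orbitCount _ (centralProductKernel_le_center hH₁ hH₂ θ) (centralProductKernel hH₁ hH₂ θ) =
      orbitCount H₁ hH₁ H₁ * orbitCount H₂ hH₂ H₂ := by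
  rw [← card_ann_eq_top, ← card_ann_eq_top, ← card_ann_eq_top, ← Nat.card_prod]
  exact Nat.card_congr (((conjClassesProd G₁ G₂).subtypeEquiv
    fun K => ann_centralProductKernel_eq_iff hH₁ hH₂ θ K).trans Equiv.subtypeProdEquivProd)

theorem prod_product_mul {ι κ M : Type*} [CommMonoid M] (s : Finset ι) (t : Finset κ) (f : ι → M)
    (g : κ → M) :
    ∏ x ∈ s ×ˢ t, f x.1 * g x.2 = (∏ i ∈ s, f i) ^ t.card * (∏ j ∈ t, g j) ^ s.card := by
  rw [Finset.prod_product]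
  simp only [Finset.prod_mul_distrib, Finset.prod_const, Finset.prod_pow]

open Classical in
theorem prod_card_carrier_centralProduct [Finite G₁] [Finite G₂] [Fintype (ConjClasses G₁)]
    [Fintype (ConjClasses G₂)] [H₁.Normal] [H₂.Normal] [Fintype (ConjClasses (G₁ ⧸ H₁))]
    [Fintype (ConjClasses (G₂ ⧸ H₂))] [Fintype (ConjClasses (CentralProduct hH₁ hH₂ θ))]
    {p : ℕ} (hp : p.Prime) (hcard₁ : Nat.card H₁ = p) (hcard₂ : Nat.card H₂ = p) :
    ∏ K : ConjClasses (CentralProduct hH₁ hH₂ θ), Nat.card K.carrier =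
      p ^ (orbitCount H₁ hH₁ H₁ * orbitCount H₂ hH₂ H₂) *
        ((∏ K : ConjClasses G₁, Nat.card K.carrier) ^ orbitCount H₂ hH₂ ⊥ *
          (∏ K : ConjClasses G₂, Nat.card K.carrier) ^ orbitCount H₁ hH₁ ⊥) *
        ((∏ K : ConjClasses (G₁ ⧸ H₁), Nat.card K.carrier) ^ orbitCount H₂ hH₂ H₂ *
          (∏ K : ConjClasses (G₂ ⧸ H₂), Nat.card K.carrier) ^ orbitCount H₁ hH₁ H₁) := by
  have := Fintype.ofFinite (ConjClasses (G₁ × G₂))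
  have e₁ := prod_card_carrier_quotient hH₁ hp hcard₁
  have e₂ := prod_card_carrier_quotient hH₂ hp hcard₂
  have e := prod_card_carrier_quotient (centralProductKernel_le_center hH₁ hH₂ θ) hp
    ((card_centralProductKernel hH₁ hH₂ θ).trans hcard₁)
  have hk₁ := card_conjClasses hH₁ hp hcard₁
  have hk₂ := card_conjClasses hH₂ hp hcard₂
  have hb₁ := card_ann_eq_top hH₁
  have hb₂ := card_ann_eq_top hH₂
  rw [Nat.card_eq_fintype_card] at hk₁ hk₂ hb₁ hb₂
  rw [Fintype.card_subtype] at hb₁ hb₂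
  have hall : ∏ K : ConjClasses (G₁ × G₂), Nat.card K.carrier =
      (∏ K : ConjClasses G₁, Nat.card K.carrier) ^ Fintype.card (ConjClasses G₂) *
        (∏ K : ConjClasses G₂, Nat.card K.carrier) ^ Fintype.card (ConjClasses G₁) := by
    rw [← Finset.card_univ, ← Finset.card_univ, ← prod_product_mul]
    exact Fintype.prod_equiv (conjClassesProd G₁ G₂) _ _ card_carrier_prod
  have hfix : ∏ K : ConjClasses (G₁ × G₂) with
        ann _ (centralProductKernel_le_center hH₁ hH₂ θ) K = centralProductKernel hH₁ hH₂ θ,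
        Nat.card K.carrier =
      (∏ K : ConjClasses G₁ with ann H₁ hH₁ K = H₁, Nat.card K.carrier) ^ orbitCount H₂ hH₂ H₂ *
        (∏ K : ConjClasses G₂ with ann H₂ hH₂ K = H₂, Nat.card K.carrier) ^
          orbitCount H₁ hH₁ H₁ := by
    rw [← hb₁, ← hb₂, ← prod_product_mul]
    refine Finset.prod_equiv (conjClassesProd G₁ G₂) (fun K => ?_) fun K _ => card_carrier_prod K
    simp only [Finset.mem_filter_univ, Finset.mem_product]
    exact ann_centralProductKernel_eq_iff hH₁ hH₂ θ K
  rw [orbitCount_centralProductKernel, hall, hfix, hk₁, hk₂] at e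
  generalize (∏ K : ConjClasses (CentralProduct hH₁ hH₂ θ), Nat.card K.carrier) = P at e ⊢
  generalize (∏ K : ConjClasses G₁, Nat.card K.carrier) = P₁ at *
  generalize (∏ K : ConjClasses G₂, Nat.card K.carrier) = P₂ at *
  generalize (∏ K : ConjClasses (G₁ ⧸ H₁), Nat.card K.carrier) = Q₁ at *
  generalize (∏ K : ConjClasses (G₂ ⧸ H₂), Nat.card K.carrier) = Q₂ at *
  generalize (∏ K : ConjClasses G₁ with ann H₁ hH₁ K = H₁, Nat.card K.carrier) = F₁ at *
  generalize (∏ K : ConjClasses G₂ with ann H₂ hH₂ K = H₂, Nat.card K.carrier) = F₂ at *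
  generalize orbitCount H₁ hH₁ H₁ = b₁ at *
  generalize orbitCount H₂ hH₂ H₂ = b₂ at *
  generalize orbitCount H₁ hH₁ ⊥ = a₁ at *
  generalize orbitCount H₂ hH₂ ⊥ = a₂ at *
  -- The identities for the factors involve `p`-th powers, so the equality is proved after raising
  -- to the power `p`. Substituting `e₁` and `e₂` yields `p ^ (p * (b₁ * b₂))` twice, and one copy
  -- cancels against the factor in `e`.
  refine Nat.pow_left_injective hp.ne_zero ?_
  refine Nat.eq_of_mul_eq_mul_left (pow_pos hp.pos (p * (b₁ * b₂))) ?_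
  calc p ^ (p * (b₁ * b₂)) * P ^ p
      = (F₁ ^ (p - 1) * P₁) ^ b₂ * (F₂ ^ (p - 1) * P₂) ^ b₁ * (P₁ ^ a₂ * P₂ ^ a₁) ^ p := by
        rw [e]; ring
    _ = _ := by
        rw [← e₁, ← e₂]
        simp only [mul_pow, ← pow_mul]
        ring

end Product

/-! ### Irreducible characters of quotients and direct products -/

section QuotientCharacters

variable {G : Type*} [Group G] {Z : Subgroup G} (hZ : Z ≤ Subgroup.center G) [Z.Normal]

/-- Pulling back along a surjection leaves the invariant subspaces unchanged. -/
theorem irrChar_comp_surjective {G' : Type*} [Group G'] (f : G →* G')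
    (hf : Function.Surjective f) {χ : G' → ℂ} (hχ : χ ∈ irrChar G') : χ ∘ f ∈ irrChar G := by
  obtain ⟨n, ρ, hρ, rfl⟩ := hχ
  refine ⟨n, ρ.comp f, isIrreducible_of_mem_iff ρ (ρ.comp f) (LinearEquiv.refl ℂ _)
    (fun g' => ?_) (fun g => ⟨f g, fun v => rfl⟩) hρ, rfl⟩
  obtain ⟨g, rfl⟩ := hf g'
  exact ⟨g, fun v => rfl⟩

/-- The scalar by which `z` acts is its central character value, here `1`; so `Z` acts trivially and
the representation descends. -/
theorem exists_irrChar_quotient (χ : irrChar G) (hχ : centralCharacter Z hZ χ = 1) :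
    ∃ ψ : irrChar (G ⧸ Z), ψ.1 ∘ QuotientGroup.mk' Z = χ.1 := by
  obtain ⟨χ, n, ρ, hρ, rfl⟩ := χ
  have hone := irrChar_one_ne_zero (character_mem_irrChar ρ hρ)
  have htriv : ∀ z : Z, ρ z = LinearMap.id := by
    intro z
    obtain ⟨c, hc⟩ := exists_eq_smul_of_commute ρ hρ (ρ z) fun g => by
      rw [← Module.End.mul_eq_comp, ← Module.End.mul_eq_comp, ← map_mul, ← map_mul,
        Subgroup.mem_center_iff.mp (hZ z.2) g]
    have h1 : ρ.character z / ρ.character 1 = 1 := DFunLike.congr_fun hχ z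
    rw [div_eq_one_iff_eq hone] at h1
    have h2 : ρ.character z = c * ρ.character 1 := by
      rw [character, hc, map_smul, character, map_one, smul_eq_mul]; rfl
    rw [h1, eq_comm, mul_eq_right₀ hone] at h2
    rw [hc, h2, one_smul]
  have : IsTrivial (ρ.comp Z.subtype) := ⟨htriv⟩
  refine ⟨⟨(ofQuotient ρ Z).character, character_mem_irrChar _ ?_⟩, rfl⟩
  refine isIrreducible_of_mem_iff ρ (ofQuotient ρ Z) (LinearEquiv.refl ℂ _)
    (fun g => ⟨(g : G ⧸ Z), fun v => rfl⟩) (fun g' => ?_) hρ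
  obtain ⟨g, rfl⟩ := QuotientGroup.mk_surjective g'
  exact ⟨g, fun v => rfl⟩

/-- The irreducible characters of `G ⧸ Z` are those of `G` with trivial central character. -/
noncomputable def irrCharQuotientEquiv :
    irrChar (G ⧸ Z) ≃ {χ : irrChar G // centralCharacter Z hZ χ = 1} :=
  Equiv.ofBijective
    (fun ψ => ⟨⟨ψ.1 ∘ QuotientGroup.mk' Z,
      irrChar_comp_surjective _ (QuotientGroup.mk'_surjective Z) ψ.2⟩, by
        ext z
        have h : QuotientGroup.mk' Z (z : G) = 1 := (QuotientGroup.eq_one_iff (z : G)).mpr z.2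
        change ψ.1 (QuotientGroup.mk' Z z) / ψ.1 (QuotientGroup.mk' Z 1) = 1
        rw [h, map_one, div_self (irrChar_one_ne_zero ψ.2)]⟩)
    ⟨fun ψ ψ' h => Subtype.ext ((QuotientGroup.mk'_surjective Z).injective_comp_right
      (congrArg (fun x => x.1.1) h)), fun χ => by
        obtain ⟨ψ, hψ⟩ := exists_irrChar_quotient hZ χ.1 χ.2
        exact ⟨ψ, Subtype.ext (Subtype.ext hψ)⟩⟩

open Classical in
theorem prod_irrChar_quotient [Fintype (irrChar G)] [Fintype (irrChar (G ⧸ Z))] :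
    ∏ ψ : irrChar (G ⧸ Z), ψ.1 1 =
      ∏ χ : irrChar G, if centralCharacter Z hZ χ = 1 then χ.1 1 else 1 := by
  rw [← Finset.prod_filter,
    Finset.prod_subtype (p := fun χ => centralCharacter Z hZ χ = 1) _ (by simp)]
  exact Fintype.prod_equiv (irrCharQuotientEquiv hZ) _ _ fun ψ => rfl

end QuotientCharacters

/-! ### Exterior products and matching central characters -/

section ProductCharacters

variable {G₁ G₂ : Type*} [Group G₁] [Group G₂]

/-- The exterior product of two class functions. -/
def extMul (χ₁ : G₁ → ℂ) (χ₂ : G₂ → ℂ) : G₁ × G₂ → ℂ := fun g => χ₁ g.1 * χ₂ g.2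

theorem sum_extMul [Fintype G₁] [Fintype G₂] (χ₁ ψ₁ : G₁ → ℂ) (χ₂ ψ₂ : G₂ → ℂ) :
    (Nat.card (G₁ × G₂) : ℂ)⁻¹ * ∑ g, extMul χ₁ χ₂ g * extMul ψ₁ ψ₂ g⁻¹ =
      ((Nat.card G₁ : ℂ)⁻¹ * ∑ g, χ₁ g * ψ₁ g⁻¹) * ((Nat.card G₂ : ℂ)⁻¹ * ∑ g, χ₂ g * ψ₂ g⁻¹) := by
  rw [Nat.card_prod, Nat.cast_mul, mul_inv, mul_mul_mul_comm, Fintype.sum_mul_sum,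
    Fintype.sum_prod_type]
  congr 1
  refine Finset.sum_congr rfl fun a _ => Finset.sum_congr rfl fun b _ => ?_
  simp only [extMul, Prod.fst_inv, Prod.snd_inv]
  ring

variable [Finite G₁] [Finite G₂]

/-- The tensor product representation has this character, and its norm is the product of two norms
equal to one. -/
theorem extMul_mem_irrChar {χ₁ : G₁ → ℂ} {χ₂ : G₂ → ℂ} (h₁ : χ₁ ∈ irrChar G₁)
    (h₂ : χ₂ ∈ irrChar G₂) : extMul χ₁ χ₂ ∈ irrChar (G₁ × G₂) := by
  classical
  have := Fintype.ofFinite G₁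
  have := Fintype.ofFinite G₂
  have hnorm : (Nat.card (G₁ × G₂) : ℂ)⁻¹ * ∑ g, extMul χ₁ χ₂ g * extMul χ₁ χ₂ g⁻¹ = 1 := by
    rw [sum_extMul, irrChar_orthonormal h₁ h₁, irrChar_orthonormal h₂ h₂, if_pos rfl, if_pos rfl,
      one_mul]
  obtain ⟨n, ρ, hρ, rfl⟩ := h₁
  obtain ⟨m, σ, hσ, rfl⟩ := h₂
  have hchar : (tprod (ρ.comp (MonoidHom.fst G₁ G₂)) (σ.comp (MonoidHom.snd G₁ G₂))).character =
      extMul ρ.character σ.character := by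
    rw [char_tensor]; rfl
  rw [← hchar] at hnorm ⊢
  exact character_mem_irrChar _ (isIrreducible_of_norm_one _ hnorm)

/-- Otherwise `χ` is orthogonal to every exterior product. Completeness in the second variable and
then in the first forces `χ (a, 1) = 0` for all `a`, contradicting `χ 1 ≠ 0`. -/
theorem exists_extMul_eq {χ : G₁ × G₂ → ℂ} (hχ : χ ∈ irrChar (G₁ × G₂)) :
    ∃ χ₁ ∈ irrChar G₁, ∃ χ₂ ∈ irrChar G₂, extMul χ₁ χ₂ = χ := by
  classical
  have := Fintype.ofFinite G₁
  have := Fintype.ofFinite G₂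
  by_contra! hne
  have hort : ∀ χ₁ ∈ irrChar G₁, ∀ χ₂ ∈ irrChar G₂,
      ∑ b, (∑ a, χ (a, b) * χ₁ a⁻¹) * χ₂ b⁻¹ = 0 := by
    intro χ₁ h₁ χ₂ h₂
    have h := irrChar_orthonormal hχ (extMul_mem_irrChar h₁ h₂)
    rw [if_neg (hne χ₁ h₁ χ₂ h₂).symm, mul_eq_zero_iff_left
      (inv_ne_zero (Nat.cast_ne_zero.mpr Nat.card_pos.ne')), Fintype.sum_prod_type_right] at h
    rw [← h]
    refine Finset.sum_congr rfl fun b _ => ?_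
    rw [Finset.sum_mul]
    exact Finset.sum_congr rfl fun a _ => mul_assoc _ _ _
  have hconj : ∀ a b c d, χ (c * a * c⁻¹, d * b * d⁻¹) = χ (a, b) := fun a b c d =>
    irrChar_conj hχ (a, b) (c, d)
  have h₂ : ∀ χ₁ ∈ irrChar G₁, (fun b => ∑ a, χ (a, b) * χ₁ a⁻¹) = 0 := fun χ₁ h₁ => by
    refine eq_zero_of_orthogonal _ (fun b d => ?_) (hort χ₁ h₁)
    refine Finset.sum_congr rfl fun a _ => ?_
    have := hconj a b 1 d
    rw [one_mul, inv_one, mul_one] at this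
    rw [this]
  have h₁ : (fun a => χ (a, 1)) = 0 := by
    refine eq_zero_of_orthogonal _ (fun a c => ?_) fun χ₁ h₁ => congrFun (h₂ χ₁ h₁) 1
    have := hconj a 1 c 1
    rwa [mul_one, one_mul, inv_one] at this
  exact irrChar_one_ne_zero hχ (congrFun h₁ 1)

/-- The irreducible characters of a direct product are the exterior products. -/
noncomputable def irrCharProdEquiv (G₁ G₂ : Type*) [Group G₁] [Group G₂] [Finite G₁] [Finite G₂] :
    irrChar G₁ × irrChar G₂ ≃ irrChar (G₁ × G₂) :=
  Equiv.ofBijective (fun x => ⟨extMul x.1.1 x.2.1, extMul_mem_irrChar x.1.2 x.2.2⟩)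
    ⟨by
      classical
      have := Fintype.ofFinite G₁
      have := Fintype.ofFinite G₂
      rintro ⟨χ₁, χ₂⟩ ⟨ψ₁, ψ₂⟩ h
      have h' : extMul χ₁.1 χ₂.1 = extMul ψ₁.1 ψ₂.1 := congrArg Subtype.val h
      have key := sum_extMul χ₁.1 ψ₁.1 χ₂.1 ψ₂.1
      rw [irrChar_orthonormal (extMul_mem_irrChar χ₁.2 χ₂.2) (extMul_mem_irrChar ψ₁.2 ψ₂.2),
        if_pos h', irrChar_orthonormal χ₁.2 ψ₁.2, irrChar_orthonormal χ₂.2 ψ₂.2] at key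
      by_cases h1 : χ₁.1 = ψ₁.1
      · by_cases h2 : χ₂.1 = ψ₂.1
        · exact Prod.ext (Subtype.ext h1) (Subtype.ext h2)
        · rw [if_neg h2, mul_zero] at key
          exact absurd key one_ne_zero
      · rw [if_neg h1, zero_mul] at key
        exact absurd key one_ne_zero, by
      rintro ⟨χ, hχ⟩
      obtain ⟨χ₁, h₁, χ₂, h₂, h⟩ := exists_extMul_eq hχ
      exact ⟨(⟨χ₁, h₁⟩, ⟨χ₂, h₂⟩), Subtype.ext h⟩⟩

variable {H₁ : Subgroup G₁} {H₂ : Subgroup G₂} (hH₁ : H₁ ≤ Subgroup.center G₁)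
  (hH₂ : H₂ ≤ Subgroup.center G₂) (θ : H₁ ≃* H₂)

/-- On `(h, θ h⁻¹)` the central character of an exterior product is the first central character at
`h` divided by the second at `θ h`. -/
theorem centralCharacter_prod_eq_one_iff (x : irrChar G₁ × irrChar G₂) :
    centralCharacter _ (centralProductKernel_le_center hH₁ hH₂ θ) (irrCharProdEquiv G₁ G₂ x) = 1 ↔
      centralCharacter H₁ hH₁ x.1 = (centralCharacter H₂ hH₂ x.2).comp θ.toMonoidHom := by
  have key : ∀ h : H₁, centralCharacter _ (centralProductKernel_le_center hH₁ hH₂ θ)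
      (irrCharProdEquiv G₁ G₂ x) ⟨_, h, rfl⟩ =
      centralCharacter H₁ hH₁ x.1 h * centralCharacter H₂ hH₂ x.2 (θ h⁻¹) := fun h =>
    (div_mul_div_comm (x.1.1 h) (x.1.1 1) (x.2.1 (θ h⁻¹ : G₂)) (x.2.1 1)).symm
  have hinv : ∀ h : H₁, centralCharacter H₂ hH₂ x.2 (θ h⁻¹) *
      centralCharacter H₂ hH₂ x.2 (θ h) = 1 := fun h => by
    rw [← map_mul, ← map_mul, inv_mul_cancel, map_one, map_one]
  constructor
  · intro h
    ext y
    have hy := key y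
    rw [h, MonoidHom.one_apply] at hy
    change _ = centralCharacter H₂ hH₂ x.2 (θ y)
    calc _ = centralCharacter H₁ hH₁ x.1 y * (centralCharacter H₂ hH₂ x.2 (θ y⁻¹) *
          centralCharacter H₂ hH₂ x.2 (θ y)) := by rw [hinv, mul_one]
      _ = _ := by rw [← mul_assoc, ← hy, one_mul]
  · intro h
    ext ⟨_, y, rfl⟩
    rw [key, h, MonoidHom.one_apply, mul_comm]
    exact hinv y

open Classical in
theorem prod_irrChar_centralProduct [H₁.Normal] [H₂.Normal] [Fintype (irrChar G₁)]
    [Fintype (irrChar G₂)] [Fintype (irrChar (G₁ ⧸ H₁))] [Fintype (irrChar (G₂ ⧸ H₂))]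
    [Fintype (irrChar (CentralProduct hH₁ hH₂ θ))] {p : ℕ} (hp : p.Prime)
    (hcard₁ : Nat.card H₁ = p) (hcard₂ : Nat.card H₂ = p) :
    ∏ χ : irrChar (CentralProduct hH₁ hH₂ θ), χ.1 1 =
      ((∏ χ : irrChar G₁, χ.1 1) ^ orbitCount H₂ hH₂ ⊥ *
          (∏ χ : irrChar G₂, χ.1 1) ^ orbitCount H₁ hH₁ ⊥) *
        ((∏ χ : irrChar (G₁ ⧸ H₁), χ.1 1) ^ orbitCount H₂ hH₂ H₂ *
          (∏ χ : irrChar (G₂ ⧸ H₂), χ.1 1) ^ orbitCount H₁ hH₁ H₁) := by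
  have := Fintype.ofFinite (irrChar (G₁ × G₂))
  have hcount₂ : ∀ χ₁ : irrChar G₁, (Finset.univ.filter fun χ₂ : irrChar G₂ =>
      centralCharacter H₁ hH₁ χ₁ = (centralCharacter H₂ hH₂ χ₂).comp θ.toMonoidHom).card =
      orbitCount H₂ hH₂ ⊥ + if centralCharacter H₁ hH₁ χ₁ = 1 then orbitCount H₂ hH₂ H₂ else 0 := by
    intro χ₁
    -- The matching condition is moved to `H₂` through `θ.symm`, where the count of characters over
    -- a fixed linear character applies.
    have h1 : centralCharacter H₁ hH₁ χ₁ = 1 ↔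
        (centralCharacter H₁ hH₁ χ₁).comp θ.symm.toMonoidHom = 1 := by
      refine ⟨fun h => by rw [h]; rfl, fun h => MonoidHom.ext fun y => ?_⟩
      have := DFunLike.congr_fun h (θ y)
      rwa [MonoidHom.comp_apply, show θ.symm.toMonoidHom (θ y) = y from θ.symm_apply_apply y]
        at this
    simp only [h1]
    rw [← card_centralCharacter_eq hH₂ hp hcard₂, Nat.card_eq_fintype_card, Fintype.card_subtype]
    congr 1
    ext χ₂
    simp only [Finset.mem_filter_univ]
    refine ⟨fun h => ?_, fun h => ?_⟩
    · rw [h]; ext y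
      exact congrArg (centralCharacter H₂ hH₂ χ₂) (θ.apply_symm_apply y).symm
    · rw [h]; ext y
      exact congrArg (centralCharacter H₁ hH₁ χ₁) (θ.symm_apply_apply y).symm
  have hcount₁ : ∀ χ₂ : irrChar G₂, (Finset.univ.filter fun χ₁ : irrChar G₁ =>
      centralCharacter H₁ hH₁ χ₁ = (centralCharacter H₂ hH₂ χ₂).comp θ.toMonoidHom).card =
      orbitCount H₁ hH₁ ⊥ + if centralCharacter H₂ hH₂ χ₂ = 1 then orbitCount H₁ hH₁ H₁ else 0 := by
    intro χ₂
    have h1 : centralCharacter H₂ hH₂ χ₂ = 1 ↔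
        (centralCharacter H₂ hH₂ χ₂).comp θ.toMonoidHom = 1 := by
      refine ⟨fun h => by rw [h]; rfl, fun h => MonoidHom.ext fun y => ?_⟩
      have := DFunLike.congr_fun h (θ.symm y)
      rwa [MonoidHom.comp_apply, show θ.toMonoidHom (θ.symm y) = y from θ.apply_symm_apply y]
        at this
    simp only [h1]
    rw [← card_centralCharacter_eq hH₁ hp hcard₁, Nat.card_eq_fintype_card, Fintype.card_subtype]
  rw [prod_irrChar_quotient (centralProductKernel_le_center hH₁ hH₂ θ),
    prod_irrChar_quotient hH₁, prod_irrChar_quotient hH₂,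
    ← Fintype.prod_equiv (irrCharProdEquiv G₁ G₂) (fun x => if centralCharacter H₁ hH₁ x.1 =
      (centralCharacter H₂ hH₂ x.2).comp θ.toMonoidHom then x.1.1 1 * x.2.1 1 else 1) _
      (fun x => ?_)]
  -- The degree of a matching pair is split into its two factors, so that each degree is raised to
  -- its number of partners.
  · calc _ = (∏ χ₁ : irrChar G₁, ∏ χ₂ : irrChar G₂, if centralCharacter H₁ hH₁ χ₁ =
            (centralCharacter H₂ hH₂ χ₂).comp θ.toMonoidHom then χ₁.1 1 else 1) *
          (∏ χ₂ : irrChar G₂, ∏ χ₁ : irrChar G₁, if centralCharacter H₁ hH₁ χ₁ =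
            (centralCharacter H₂ hH₂ χ₂).comp θ.toMonoidHom then χ₂.1 1 else 1) := by
          rw [Finset.prod_comm (s := (Finset.univ : Finset (irrChar G₂))),
            ← Finset.prod_mul_distrib, Fintype.prod_prod_type]
          refine Finset.prod_congr rfl fun χ₁ _ => ?_
          rw [← Finset.prod_mul_distrib]
          refine Finset.prod_congr rfl fun χ₂ _ => ?_
          split_ifs
          · rfl
          · rw [one_mul]
      _ = _ := by
          simp only [← Finset.prod_filter, Finset.prod_const, hcount₁, hcount₂, pow_add, pow_ite,
            pow_zero, Finset.prod_mul_distrib, Finset.prod_pow]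
          simp only [Finset.prod_filter, ← Finset.prod_pow, ite_pow, one_pow]
          ring
  · simp only [centralCharacter_prod_eq_one_iff]
    rfl

end ProductCharacters

/-! ### Assembling the formula -/

theorem haradaNumber_eq_div (G : Type*) [Group G] [Fintype (ConjClasses G)]
    [Fintype (irrChar G)] :
    haradaNumber G =
      ((∏ K : ConjClasses G, Nat.card K.carrier : ℕ) : ℂ) / ∏ χ : irrChar G, χ.1 1 := by
  rw [haradaNumber, finprod_eq_prod_of_fintype, ← finprod_set_coe_eq_finprod_mem,
    finprod_eq_prod_of_fintype, Nat.cast_prod]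

end Harada

theorem mainTheorem12 {G₁ : Type*} {G₂ : Type*} [Group G₁] [Group G₂] [Finite G₁] [Finite G₂]
    (p : ℕ) (hp : p.Prime) (H₁ : Subgroup G₁) (H₂ : Subgroup G₂)
    (hH₁ : H₁ ≤ Subgroup.center G₁) (hH₂ : H₂ ≤ Subgroup.center G₂)
    (hcard₁ : Nat.card H₁ = p) (hcard₂ : Nat.card H₂ = p) (θ : H₁ ≃* H₂) :
    haveI : H₁.Normal := Harada.normal_of_central hH₁
    haveI : H₂.Normal := Harada.normal_of_central hH₂
    Harada.haradaNumber (Harada.CentralProduct hH₁ hH₂ θ) =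
        (p : ℂ) ^ (Harada.orbitCount H₁ hH₁ H₁ * Harada.orbitCount H₂ hH₂ H₂) *
          (Harada.haradaNumber G₁ ^ Harada.orbitCount H₂ hH₂ ⊥ *
            Harada.haradaNumber G₂ ^ Harada.orbitCount H₁ hH₁ ⊥) *
          (Harada.haradaNumber (G₁ ⧸ H₁) ^ Harada.orbitCount H₂ hH₂ H₂ *
            Harada.haradaNumber (G₂ ⧸ H₂) ^ Harada.orbitCount H₁ hH₁ H₁) ∧
      ((∃ m : ℤ, Harada.haradaNumber G₁ = m) → (∃ m : ℤ, Harada.haradaNumber G₂ = m) →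
        (∃ m : ℤ, Harada.haradaNumber (G₁ ⧸ H₁) = m) →
        (∃ m : ℤ, Harada.haradaNumber (G₂ ⧸ H₂) = m) →
        ∃ m : ℤ, Harada.haradaNumber (Harada.CentralProduct hH₁ hH₂ θ) = m) := by
  have : H₁.Normal := Harada.normal_of_central hH₁
  have : H₂.Normal := Harada.normal_of_central hH₂
  have := Fintype.ofFinite (ConjClasses G₁)
  have := Fintype.ofFinite (ConjClasses G₂)
  have := Fintype.ofFinite (ConjClasses (G₁ ⧸ H₁))
  have := Fintype.ofFinite (ConjClasses (G₂ ⧸ H₂))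
  have := Fintype.ofFinite (ConjClasses (Harada.CentralProduct hH₁ hH₂ θ))
  have := Fintype.ofFinite (Harada.irrChar G₁)
  have := Fintype.ofFinite (Harada.irrChar G₂)
  have := Fintype.ofFinite (Harada.irrChar (G₁ ⧸ H₁))
  have := Fintype.ofFinite (Harada.irrChar (G₂ ⧸ H₂))
  have := Fintype.ofFinite (Harada.irrChar (Harada.CentralProduct hH₁ hH₂ θ))
  refine (and_iff_left_of_imp fun heq => ?_).mpr ?_
  -- All exponents in the formula are natural numbers, so no denominators arise.
  · rintro ⟨m₁, h₁⟩ ⟨m₂, h₂⟩ ⟨n₁, k₁⟩ ⟨n₂, k₂⟩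
    rw [h₁, h₂, k₁, k₂] at heq
    refine ⟨(p : ℤ) ^ (Harada.orbitCount H₁ hH₁ H₁ * Harada.orbitCount H₂ hH₂ H₂) *
      (m₁ ^ Harada.orbitCount H₂ hH₂ ⊥ * m₂ ^ Harada.orbitCount H₁ hH₁ ⊥) *
      (n₁ ^ Harada.orbitCount H₂ hH₂ H₂ * n₂ ^ Harada.orbitCount H₁ hH₁ H₁), ?_⟩
    rw [heq]
    push_cast
    rfl
  · simp only [Harada.haradaNumber_eq_div]
    rw [Harada.prod_card_carrier_centralProduct hH₁ hH₂ θ hp hcard₁ hcard₂,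
      Harada.prod_irrChar_centralProduct hH₁ hH₂ θ hp hcard₁ hcard₂]
    simp only [Nat.cast_mul, Nat.cast_pow, div_eq_mul_inv, mul_pow, inv_pow, mul_inv]
    ring
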